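/- Let $d, N \ge 1$, let $f$ be a Borel-measurable real-valued function on $[0,1]^d$, and let $g : [0,1]^d \to \mathbb{R}$ be a Borel-measurable function with $g(\mathbf{x}) > 0$ for all $\mathbf{x} \in [0,1]^d$ which is the density, with respect to Lebesgue measure, of a Borel probability measure $\mu_g$ on $[0,1]^d$, i.e. $\mu_g(A) = \int_A g(\mathbf{x})\,d\mathbf{x}$ for all Borel sets $A \subset [0,1]^d$. Assume that $f/g$ has bounded variation in the sense of Hardy and Krause anchored at $\mathbf{1}$, i.e. $\operatorname{Var}_{HK}(f/g) < \infty$. Let $\mathbf{x}_1, \dots, \mathbf{x}_N$ be points in $[0,1]^d$. Then $f$ is Lebesgue integrable on $[0,1]^d$ and $$\left| \frac{1}{N} \sum_{n=1}^N \frac{f(\mathbf{x}_n)}{g(\mathbf{x}_n)} - \int_{[0,1]^d} f(\mathbf{x})\,d\mathbf{x} \right| \le \operatorname{Var}_{HK}\!\left(\frac{f}{g}\right) \cdot D_N^*(\mathbf{x}_1, \dots, \mathbf{x}_N; \mu_g).$$ Here the star-discrepancy with respect to a Borel probability measure $\mu$ is $$D_N^*(\mathbf{x}_1,\dots,\mathbf{x}_N;\mu)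 = \sup_{\mathbf{a} \in [0,1]^d} \left| \frac{1}{N} \sum_{n=1}^N \mathbf{1}_{[\mathbf{0},\mathbf{a}]}(\mathbf{x}_n) - \mu([\mathbf{0},\mathbf{a}]) \right|,$$ where $[\mathbf{0},\mathbf{a}] = \prod_{i=1}^d [0,a_i]$. The variation in the sense of Hardy and Krause anchored at $\mathbf{1}$ is $$\operatorname{Var}_{HK}(h) = \sum_{\emptyset \neq u \subseteq \{1,\dots,d\}} V\big(h|_{U_u}\big),$$ where $h|_{U_u}$ is the restriction of $h$ to the face $U_u = \{\mathbf{x} \in [0,1]^d : x_j = 1 \text{ for all } j \notin u\}$, regarded as a function on $[0,1]^{u}$, and where for a function $h$ on $[0,1]^s$ the variation in the sense of Vitali is $$V(h) = \sup_{\mathcal{P}} \sum_{A \in \mathcal{P}} |\Delta(h; A)|, \qquad \Delta\Big(h;\prod_{i=1}^s [a_i,b_i]\Big) = \sum_{j \in \{0,1\}^s} (-1)^{j_1+\dots+j_s}\, h\big(b_1 + j_1(a_1-b_1), \dots, b_s + j_s(a_s-b_s)\big),$$ the supremum being taken over all partitions $\mathcal{P}$ of $[0,1]^s$ into axis-parallel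 boxes generated by $s$ one-dimensional partitions $0 = t_0 < t_1 < \dots < t_m = 1$ of $[0,1]$. -/

import Mathlib

open MeasureTheory
open scoped unitInterval

namespace QMC

noncomputable section

/-- A partition `0 = x₀ < x₁ < ⋯ < x_m = 1` of the unit interval. -/
structure UnitPartition where
  /-- the number of subintervals -/
  m : ℕ
  /-- the partition points -/
  pts : Fin (m + 1) → I
  strictMono : StrictMono pts
  first : pts 0 = 0
  last : pts (Fin.last m) = 1

/-- The quasi-volume `Δ(f; [a, b])`: the alternating sum of the values of `f` at the vertices of the
box `[a, b]`; the vertex belonging to `J` has the coordinates `a i` for `i ∈ J` and `b i`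
for `i ∉ J`. -/
def quasiVolume {ι : Type*} [Fintype ι] [DecidableEq ι] (f : (ι → I) → ℝ) (a b : ι → I) : ℝ :=
  ∑ J : Finset ι, (-1 : ℝ) ^ J.card * f (fun i => if i ∈ J then a i else b i)

/-- The variation in the sense of Vitali of a function on the cube `[0,1]^ι`: the supremum, over all
families `P` of one-dimensional partitions, of the sum of the absolute values of the quasi-volumes
of all boxes of the grid generated by `P`. -/
def vitaliVariation {ι : Type*} [Fintype ι] [DecidableEq ι] (f : (ι → I) → ℝ) : ENNReal :=
  ⨆ P : ι → UnitPartition, ∑ l : (∀ i, Fin (P i).m),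
    ENNReal.ofReal |quasiVolume f (fun i => (P i).pts (l i).castSucc)
      (fun i => (P i).pts (l i).succ)|

/-- The parametrization of the face `{x : x i = 1 for all i ∉ u}` of `[0,1]^d` by `[0,1]^u`. -/
def faceOne {d : ℕ} (u : Finset (Fin d)) (y : u → I) : Fin d → I :=
  fun i => if h : i ∈ u then y ⟨i, h⟩ else 1

/-- The variation in the sense of Hardy and Krause, anchored at `(1, …, 1)`. -/
def hkVariation {d : ℕ} (f : (Fin d → I) → ℝ) : ENNReal :=
  ∑ u : Finset (Fin d) with u.Nonempty, vitaliVariation (fun y : u → I => f (faceOne u y))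

/-- The star-discrepancy with respect to `μ` of the points `x 0, …, x (N - 1)`: the supremum over
all closed boxes `[0, a] ⊆ [0,1]^d`. -/
def starDiscrepancy {d N : ℕ} (x : Fin N → Fin d → I) (μ : Measure (Fin d → I)) : ℝ :=
  ⨆ a : Fin d → I, |(1 / (N : ℝ)) * ∑ n, (Set.Icc 0 a).indicator (fun _ => (1 : ℝ)) (x n)
    - μ.real (Set.Icc 0 a)|

end

end QMC

/-!
With `h = f / g` the claim is the Koksma–Hlawka inequality for `h` and the probability measure
`μg`: as `g > 0`, the integral of `f` is the integral of `h` against `μg`.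

For finitely supported measures the inequality is algebra. On a finite grid, `h` is a signed
sum, over the faces `U_u` and the cells of the induced grid on each face, of the quasi-volume of
the cell times the indicator of an anchored box (`grid_expansion`). Let a finitely supported signed
measure have total mass zero and give mass at most `D` in absolute value to every anchored box. If
the grid contains its support, its integral of `h` is a combination of masses of such boxes, whose
coefficients have absolute sum at most `Var_HK(h)`; the face `u = ∅` drops out. So the integral is
at most `Var_HK(h) * D` in absolute value (`abs_sum_mul_le`). Applied to the difference of two unit
masses this also shows that `h` is bounded, hence integrable.

To pass to `μg` no regularity of `h` is needed beyond measurability: partition the cube into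
finitely many measurable classes on which `h` and all coordinates are nearly constant, and move the
mass of each class to one of its points. The integral of `h` hardly changes. The mass of a box
`[0, a]` changes by at most the masses of `d` thin slabs about its upper faces, and these are
uniformly small by absolute continuity (`exists_slab_measure_le`). The star-discrepancy therefore
controls the discretized measure up to an error that tends to zero.
-/

namespace QMC

/-! ### Expanding a function on a grid into indicators of anchored boxes -/

/-- The quasi-volume on the face `faceOne u` of the grid cell with index `l`. -/
noncomputable def cellDelta {d : ℕ} (h : (Fin d → I) → ℝ) (P : UnitPartition) (u : Finset (Fin d))
    (l : u → Fin P.m) : ℝ :=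
  quasiVolume (fun y : u → I => h (faceOne u y)) (fun i => P.pts (l i).castSucc)
    (fun i => P.pts (l i).succ)

/-- The lower corner of the grid cell with index `l` on the face `faceOne u`, as a point of the
cube. -/
noncomputable def lowerCorner {d : ℕ} (P : UnitPartition) (u : Finset (Fin d))
    (l : u → Fin P.m) : Fin d → I :=
  faceOne u fun i => P.pts (l i).castSucc

theorem quasiVolume_prod {ι : Type*} [Fintype ι] [DecidableEq ι] (c : ℝ) (φ : ι → I → ℝ)
    (a b : ι → I) :
    quasiVolume (fun y => c * ∏ i, φ i (y i)) a b = c * ∏ i, (φ i (b i) - φ i (a i)) := by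
  have e : ∀ i, φ i (b i) - φ i (a i) = (-1) * φ i (a i) + φ i (b i) := fun i => by ring
  simp only [quasiVolume, e, Fintype.prod_add, Finset.mul_sum]
  refine Finset.sum_congr rfl fun J _ => ?_
  rw [← Finset.prod_mul_prod_compl J, Finset.prod_mul_distrib, Finset.prod_const]
  have h1 : ∏ i ∈ J, φ i (if i ∈ J then a i else b i) = ∏ i ∈ J, φ i (a i) :=
    Finset.prod_congr rfl fun i hi => by rw [if_pos hi]
  have h2 : ∏ i ∈ Jᶜ, φ i (if i ∈ J then a i else b i) = ∏ i ∈ Jᶜ, φ i (b i) :=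
    Finset.prod_congr rfl fun i hi => by rw [if_neg (Finset.mem_compl.1 hi)]
  rw [h1, h2]
  ring

theorem prod_faceOne {d : ℕ} (φ : Fin d → I → ℝ) (u : Finset (Fin d)) (y : u → I) :
    ∏ i, φ i (faceOne u y i) = (∏ i ∈ uᶜ, φ i 1) * ∏ i : u, φ i (y i) := by
  rw [← Finset.prod_mul_prod_compl u, mul_comm]
  congr 1
  · exact Finset.prod_congr rfl fun i hi => by rw [faceOne, dif_neg (Finset.mem_compl.1 hi)]
  · rw [← Finset.prod_coe_sort u]
    exact Finset.prod_congr rfl fun i _ => by rw [faceOne, dif_pos i.2]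

theorem cellDelta_prod {d : ℕ} (φ : Fin d → I → ℝ) (P : UnitPartition) (u : Finset (Fin d))
    (l : u → Fin P.m) :
    cellDelta (fun x => ∏ i, φ i (x i)) P u l =
      (∏ i ∈ uᶜ, φ i 1) * ∏ i : u, (φ i (P.pts (l i).succ) - φ i (P.pts (l i).castSucc)) := by
  simp only [cellDelta, prod_faceOne]
  exact quasiVolume_prod _ (fun i : u => φ i) _ _

theorem cellDelta_sum {d : ℕ} {κ : Type*} (s : Finset κ) (c : κ → ℝ)
    (h : κ → (Fin d → I) → ℝ) (P : UnitPartition) (u : Finset (Fin d)) (l : u → Fin P.m) :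
    cellDelta (fun x => ∑ p ∈ s, c p * h p x) P u l = ∑ p ∈ s, c p * cellDelta (h p) P u l := by
  simp only [cellDelta, quasiVolume, Finset.mul_sum]
  rw [Finset.sum_comm]
  refine Finset.sum_congr rfl fun p _ => Finset.sum_congr rfl fun J _ => by ring

theorem one_mem_range_pts (P : UnitPartition) : 1 ∈ Set.range P.pts := ⟨_, P.last⟩

theorem cellDelta_congr {d : ℕ} {h h' : (Fin d → I) → ℝ} {P : UnitPartition}
    (hh : ∀ x, (∀ i, x i ∈ Set.range P.pts) → h x = h' x) (u : Finset (Fin d))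
    (l : u → Fin P.m) : cellDelta h P u l = cellDelta h' P u l := by
  refine Finset.sum_congr rfl fun J _ => ?_
  congr 1
  refine hh _ fun i => ?_
  unfold faceOne
  split_ifs
  · beta_reduce
    split_ifs <;> exact ⟨_, rfl⟩
  · exact one_mem_range_pts P

theorem sum_sub_of_le {m : ℕ} (g : Fin (m + 1) → ℝ) (k : Fin (m + 1)) :
    ∑ l : Fin m, (if k ≤ l.castSucc then g l.succ - g l.castSucc else 0) =
      g (Fin.last m) - g k := by
  induction m with
  | zero => simp [Fin.fin_one_eq_zero k]
  | succ m ih =>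
    rw [Fin.sum_univ_castSucc]
    refine Fin.lastCases ?_ (fun k => ?_) k
    · rw [Finset.sum_eq_zero fun j _ => if_neg ?_, if_neg ?_]
      · simp
      · simp [Fin.le_def]
      · simp [Fin.le_def]
    · have := ih (fun j => g j.castSucc) k
      simp only [Fin.castSucc_le_castSucc_iff, Fin.succ_castSucc, this]
      rw [if_pos (Fin.le_last k)]
      simp

theorem mem_Icc_lowerCorner {d : ℕ} (P : UnitPartition) (u : Finset (Fin d)) (l : u → Fin P.m)
    (k : Fin d → Fin (P.m + 1)) :
    (fun i => P.pts (k i)) ∈ Set.Icc 0 (lowerCorner P u l) ↔ ∀ i : u, k i ≤ (l i).castSucc := by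
  constructor
  · intro h i
    have := h.2 i
    simpa [lowerCorner, faceOne, P.strictMono.le_iff_le] using this
  · intro h
    refine ⟨fun i => (P.pts (k i)).2.1, fun i => ?_⟩
    unfold lowerCorner faceOne
    split_ifs with hi
    · exact P.strictMono.monotone (h ⟨i, hi⟩)
    · exact (P.pts (k i)).2.2

/-- The grid expansion for a product function: summing over the cells makes each factor telescope,
and the sum over the faces is the expansion of `∏ i, ((φ i (x i) - φ i 1) + φ i 1)`. -/
theorem grid_expansion_prod {d : ℕ} (φ : Fin d → I → ℝ) (P : UnitPartition)
    (x : Fin d → I) (hx : ∀ i, x i ∈ Set.range P.pts) :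
    ∏ i, φ i (x i) = ∑ u : Finset (Fin d), (-1 : ℝ) ^ u.card * ∑ l : u → Fin P.m,
      (Set.Icc 0 (lowerCorner P u l)).indicator (fun _ => (1 : ℝ)) x *
        cellDelta (fun x => ∏ i, φ i (x i)) P u l := by
  classical
  choose k hk using hx
  obtain rfl : (fun i => P.pts (k i)) = x := funext hk
  have e : ∀ i, φ i (P.pts (k i)) = (-1) * (φ i 1 - φ i (P.pts (k i))) + φ i 1 :=
    fun i => by ring
  rw [Finset.prod_congr rfl fun i _ => e i, Fintype.prod_add]
  refine Finset.sum_congr rfl fun u _ => ?_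
  rw [Finset.prod_mul_distrib, Finset.prod_const, mul_assoc]
  congr 1
  have tele : ∀ i, φ i 1 - φ i (P.pts (k i)) = ∑ l : Fin P.m,
      (if k i ≤ l.castSucc then φ i (P.pts l.succ) - φ i (P.pts l.castSucc) else 0) := fun i => by
    rw [sum_sub_of_le (fun j => φ i (P.pts j)), P.last]
  rw [← Finset.prod_coe_sort u, Finset.prod_congr rfl fun (i : u) _ => tele i, Fintype.prod_sum,
    Finset.sum_mul]
  refine Finset.sum_congr rfl fun l _ => ?_
  rw [cellDelta_prod]
  by_cases h : ∀ i : u, k i ≤ (l i).castSucc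
  · rw [Set.indicator_of_mem ((mem_Icc_lowerCorner P u l k).2 h),
      Finset.prod_congr rfl fun (i : u) _ => if_pos (h i)]
    ring
  · rw [Set.indicator_of_notMem (mt (mem_Icc_lowerCorner P u l k).1 h)]
    push Not at h
    obtain ⟨i, hi⟩ := h
    rw [Finset.prod_eq_zero (Finset.mem_univ i) (if_neg (not_le.2 hi))]
    ring

/-- On grid points, a function is the signed sum over all faces and cells of the quasi-volume of
the cell times the indicator of the box spanned by `0` and the lower corner of the cell. Both sides
are linear in `h` and only see its values on the grid, where `h` is a combination of products of
one-dimensional indicators. -/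
theorem grid_expansion {d : ℕ} (h : (Fin d → I) → ℝ) (P : UnitPartition)
    (x : Fin d → I) (hx : ∀ i, x i ∈ Set.range P.pts) :
    h x = ∑ u : Finset (Fin d), (-1 : ℝ) ^ u.card * ∑ l : u → Fin P.m,
      (Set.Icc 0 (lowerCorner P u l)).indicator (fun _ => (1 : ℝ)) x * cellDelta h P u l := by
  classical
  let φ : (Fin d → Fin (P.m + 1)) → Fin d → I → ℝ := fun p i t => if t = P.pts (p i) then 1 else 0
  let H : (Fin d → I) → ℝ := fun x => ∑ p : Fin d → Fin (P.m + 1),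
    h (fun i => P.pts (p i)) * ∏ i, φ p i (x i)
  have hH : ∀ x, (∀ i, x i ∈ Set.range P.pts) → h x = H x := by
    intro x hx
    choose k hk using hx
    obtain rfl : (fun i => P.pts (k i)) = x := funext hk
    simp only [H]
    rw [Finset.sum_eq_single k]
    · simp [φ]
    · intro p _ hp
      obtain ⟨i, hi⟩ := Function.ne_iff.1 hp
      rw [Finset.prod_eq_zero (Finset.mem_univ i), mul_zero]
      exact if_neg fun h => hi (P.strictMono.injective h).symm
    · simp
  rw [hH x hx]
  simp only [cellDelta_congr hH, H, cellDelta_sum]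
  rw [Finset.sum_congr rfl fun p _ => by rw [grid_expansion_prod (φ p) P x hx]]
  simp only [Finset.mul_sum]
  rw [Finset.sum_comm]
  refine Finset.sum_congr rfl fun u _ => ?_
  rw [Finset.sum_comm]
  exact Finset.sum_congr rfl fun l _ => Finset.sum_congr rfl fun p _ => by ring

/-- Any finite subset of the unit interval consists of points of a common partition. -/
theorem exists_unitPartition (T : Finset I) : ∃ P : UnitPartition, ∀ t ∈ T, t ∈ Set.range P.pts := by
  classical
  set S : Finset I := insert 0 (insert 1 T) with hS
  have h0 : (0 : I) ∈ S := by simp [hS]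
  have h1 : (1 : I) ∈ S := by simp [hS]
  have hc : S.card = (S.card - 1) + 1 := by
    have := Finset.card_pos.2 ⟨_, h0⟩
    omega
  refine ⟨⟨S.card - 1, S.orderEmbOfFin hc, (S.orderEmbOfFin hc).strictMono, ?_, ?_⟩, ?_⟩
  · refine (Finset.orderEmbOfFin_zero hc (Nat.succ_pos _)).trans ?_
    exact le_antisymm (Finset.min'_le _ _ h0) unitInterval.nonneg'
  · refine (Finset.orderEmbOfFin_last hc (Nat.succ_pos _)).trans ?_
    exact le_antisymm unitInterval.le_one' (Finset.le_max' _ _ h1)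
  · intro t ht
    rw [Finset.range_orderEmbOfFin]
    simp [hS, ht]

/-! ### The finite Koksma–Hlawka inequality -/

theorem sum_abs_cellDelta_le {d : ℕ} {h : (Fin d → I) → ℝ} (P : UnitPartition) {u : Finset (Fin d)}
    (hV : vitaliVariation (fun y : u → I => h (faceOne u y)) ≠ ⊤) :
    ∑ l : u → Fin P.m, |cellDelta h P u l| ≤
      (vitaliVariation (fun y : u → I => h (faceOne u y))).toReal := by
  rw [← ENNReal.ofReal_le_iff_le_toReal hV, ENNReal.ofReal_sum_of_nonneg fun _ _ => abs_nonneg _]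
  exact le_iSup_of_le (fun _ => P) le_rfl

/-- For finitely many weighted points of total weight zero, the weighted sum of `h` is controlled
by the weights of the anchored boxes. The face `u = ∅` contributes only the total weight. -/
theorem abs_sum_mul_le {d : ℕ} {h : (Fin d → I) → ℝ} (hV : hkVariation h ≠ ⊤) {κ : Type*}
    [Fintype κ] (w : κ → ℝ) (z : κ → Fin d → I) (hw : ∑ k, w k = 0) {D : ℝ}
    (hD : ∀ a, |∑ k, w k * (Set.Icc 0 a).indicator (fun _ => (1 : ℝ)) (z k)| ≤ D) :
    |∑ k, w k * h (z k)| ≤ (hkVariation h).toReal * D := by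
  classical
  obtain ⟨P, hP⟩ := exists_unitPartition
    (Finset.univ.image fun p : κ × Fin d => z p.1 p.2)
  replace hP : ∀ k i, z k i ∈ Set.range P.pts := fun k i =>
    hP _ (Finset.mem_image_of_mem (fun p : κ × Fin d => z p.1 p.2) (Finset.mem_univ (k, i)))
  have hVu : ∀ u ∈ ({u : Finset (Fin d) | u.Nonempty} : Finset (Finset (Fin d))),
      vitaliVariation (fun y : u → I => h (faceOne u y)) ≠ ⊤ := ENNReal.sum_ne_top.1 hV
  have key : ∑ k, w k * h (z k) = ∑ u : Finset (Fin d), (-1 : ℝ) ^ u.card * ∑ l : u → Fin P.m,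
      cellDelta h P u l *
        ∑ k, w k * (Set.Icc 0 (lowerCorner P u l)).indicator (fun _ => (1 : ℝ)) (z k) := by
    rw [Finset.sum_congr rfl fun k _ => by rw [grid_expansion h P (z k) (hP k)]]
    simp only [Finset.mul_sum]
    rw [Finset.sum_comm]
    refine Finset.sum_congr rfl fun u _ => ?_
    rw [Finset.sum_comm]
    exact Finset.sum_congr rfl fun l _ => Finset.sum_congr rfl fun p _ => by ring
  have hempty : ∀ u ∈ Finset.univ, u ∉ ({u : Finset (Fin d) | u.Nonempty} : Finset _) →
      (-1 : ℝ) ^ u.card * ∑ l : u → Fin P.m, cellDelta h P u l *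
        ∑ k, w k * (Set.Icc 0 (lowerCorner P u l)).indicator (fun _ => (1 : ℝ)) (z k) = 0 := by
    intro u _ hu
    obtain rfl : u = ∅ := by simpa [Finset.not_nonempty_iff_eq_empty] using hu
    have : ∀ (l : ((∅ : Finset (Fin d)) : Finset (Fin d)) → Fin P.m) k,
        z k ∈ Set.Icc 0 (lowerCorner P ∅ l) := fun l k =>
      ⟨fun i => (z k i).2.1, fun i => by
        unfold lowerCorner faceOne
        rw [dif_neg (Finset.notMem_empty i)]
        exact (z k i).2.2⟩
    simp [Set.indicator_of_mem (this _ _), hw]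
  rw [key, ← Finset.sum_subset (Finset.subset_univ _) hempty, hkVariation,
    ENNReal.toReal_sum hVu, Finset.sum_mul]
  refine (Finset.abs_sum_le_sum_abs _ _).trans (Finset.sum_le_sum fun u hu => ?_)
  have hD0 : 0 ≤ D := (abs_nonneg _).trans (hD 0)
  rw [abs_mul, abs_pow, abs_neg, abs_one, one_pow, one_mul]
  refine (Finset.abs_sum_le_sum_abs _ _).trans ?_
  refine le_trans ?_ (mul_le_mul_of_nonneg_right (sum_abs_cellDelta_le P (hVu u hu)) hD0)
  rw [Finset.sum_mul]
  refine Finset.sum_le_sum fun l _ => ?_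
  rw [abs_mul]
  exact mul_le_mul_of_nonneg_left (hD _) (abs_nonneg _)

/-- A function of bounded Hardy–Krause variation is bounded: compare the unit masses at `x` and
at `1`. -/
theorem abs_sub_apply_one_le {d : ℕ} {h : (Fin d → I) → ℝ} (hV : hkVariation h ≠ ⊤)
    (x : Fin d → I) : |h x - h 1| ≤ (hkVariation h).toReal := by
  have := abs_sum_mul_le hV ![1, -1] ![x, 1] (by simp) (D := 1) fun a => by
    simp only [Fin.sum_univ_two, Matrix.cons_val_zero, Matrix.cons_val_one]
    by_cases h1 : x ∈ Set.Icc 0 a <;> by_cases h2 : 1 ∈ Set.Icc 0 a <;> simp [h1, h2]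
  simpa [Fin.sum_univ_two, ← sub_eq_add_neg] using this

/-! ### Discretizing the measure -/

/-- Finitely many bounded measurable functions are approximated uniformly by their values at the
representatives `p` of the classes of a finite measurable partition `q`. The classes are those
on which each `⌊ψ i / ε⌋` is constant. -/
theorem exists_finite_discretization {α ι : Type} [MeasurableSpace α] [Finite ι]
    (ψ : ι → α → ℝ) (hψ : ∀ i, Measurable (ψ i)) {B : ℝ} (hB : ∀ i y, |ψ i y| ≤ B)
    {ε : ℝ} (hε : 0 < ε) :
    ∃ (κ : Type) (_ : Fintype κ) (_ : MeasurableSpace κ) (_ : MeasurableSingletonClass κ)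
      (q : α → κ) (p : κ → α), Measurable q ∧ ∀ i y, |ψ i (p (q y)) - ψ i y| ≤ ε := by
  let Φ : α → ι → ℤ := fun y i => ⌊ψ i y / ε⌋
  have hΦ : Measurable Φ :=
    measurable_pi_lambda _ fun i => Int.measurable_floor.comp ((hψ i).div_const ε)
  have hfin : (Set.range Φ).Finite := by
    refine (Set.Finite.pi fun _ : ι => Set.finite_Icc ⌊-B / ε⌋ ⌊B / ε⌋).subset ?_
    rintro _ ⟨y, rfl⟩ i -
    have := abs_le.1 (hB i y)
    exact ⟨Int.floor_mono (by gcongr; exact this.1), Int.floor_mono (by gcongr; exact this.2)⟩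
  have hc : Countable ι := Finite.to_countable
  refine ⟨Set.range Φ, hfin.fintype, inferInstance, inferInstance, fun y => ⟨Φ y, y, rfl⟩,
    fun c => c.2.choose, hΦ.subtype_mk, fun i y => ?_⟩
  have hs : Φ (Exists.choose (⟨y, rfl⟩ : Φ y ∈ Set.range Φ)) = Φ y :=
    Exists.choose_spec (⟨y, rfl⟩ : Φ y ∈ Set.range Φ)
  set y' := Exists.choose (⟨y, rfl⟩ : Φ y ∈ Set.range Φ) with hy'
  have h1 := (Int.abs_sub_lt_one_of_floor_eq_floor (congrFun hs i)).le
  rw [← sub_div, abs_div, abs_of_pos hε, div_le_one hε] at h1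
  exact h1

/-- If `μ` is finite and absolutely continuous, thin slabs orthogonal to a coordinate axis have
uniformly small measure. -/
theorem exists_slab_measure_le {d : ℕ} {G : (Fin d → I) → ENNReal}
    (hG : ∫⁻ y, G y ≠ ⊤) {ε : ℝ} (hε : 0 < ε) :
    ∃ δ > 0, ∀ (i : Fin d) (t : I),
      (volume.withDensity G).real {y | |(y i : ℝ) - t| ≤ δ} ≤ ε := by
  obtain ⟨η, hη, h⟩ := exists_pos_setLIntegral_lt_of_measure_lt hG
    (ENNReal.ofReal_pos.2 hε).ne'
  obtain ⟨δ, hδ, hδη⟩ : ∃ δ : ℝ, 0 < δ ∧ ENNReal.ofReal (2 * δ) < η := by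
    obtain ⟨c, hc0, hc⟩ := ENNReal.lt_iff_exists_nnreal_btwn.1 hη
    have hc0' : (0 : ℝ) < c := by exact_mod_cast hc0
    refine ⟨c / 2, by positivity, ?_⟩
    rwa [mul_div_cancel₀ _ two_ne_zero, ENNReal.ofReal_coe_nnreal]
  refine ⟨δ, hδ, fun i t => ?_⟩
  have hS : MeasurableSet {s : I | |(s : ℝ) - t| ≤ δ} :=
    measurableSet_le (by fun_prop) measurable_const
  have hT : MeasurableSet {y : Fin d → I | |(y i : ℝ) - t| ≤ δ} :=
    measurableSet_le (by fun_prop) measurable_const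
  have hvol : volume {y : Fin d → I | |(y i : ℝ) - t| ≤ δ} ≤ ENNReal.ofReal (2 * δ) := by
    have e := (measurePreserving_eval (fun _ : Fin d => (volume : Measure I)) i).measure_preimage
      hS.nullMeasurableSet
    refine (e.le : volume {y : Fin d → I | |(y i : ℝ) - t| ≤ δ} ≤ _).trans ?_
    rw [unitInterval.volume_apply]
    refine (measure_mono (t := Set.Icc ((t : ℝ) - δ) (t + δ)) ?_).trans ?_
    · rintro _ ⟨s, hs, rfl⟩
      have := abs_le.1 (show |(s : ℝ) - t| ≤ δ from hs)
      constructor <;> linarith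
    · rw [Real.volume_Icc]
      exact ENNReal.ofReal_le_ofReal (by linarith)
  rw [measureReal_def, withDensity_apply _ hT]
  exact ENNReal.toReal_le_of_le_ofReal hε.le (h _ (hvol.trans_lt hδη)).le

/-- Moving a point by at most `δ` in each coordinate changes its membership in `[0, a]` only if
the point lies in a slab of half-width `δ` about one of the upper faces. -/
theorem abs_indicator_sub_le {d : ℕ} (a y y' : Fin d → I) {δ : ℝ}
    (hy : ∀ i, |(y' i : ℝ) - y i| ≤ δ) :
    |(Set.Icc 0 a).indicator (fun _ => (1 : ℝ)) y' - (Set.Icc 0 a).indicator (fun _ => (1 : ℝ)) y| ≤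
      ∑ i, {z : Fin d → I | |(z i : ℝ) - a i| ≤ δ}.indicator (fun _ => (1 : ℝ)) y := by
  have hnn : ∀ i ∈ Finset.univ,
      0 ≤ {z : Fin d → I | |(z i : ℝ) - a i| ≤ δ}.indicator (fun _ => (1 : ℝ)) y :=
    fun i _ => Set.indicator_nonneg (fun _ _ => zero_le_one) _
  have hmem : ∀ z : Fin d → I, z ∈ Set.Icc 0 a ↔ ∀ i, (z i : ℝ) ≤ a i := fun z =>
    ⟨fun h i => h.2 i, fun h => ⟨fun i => (z i).2.1, fun i => h i⟩⟩
  have hslab : ∀ i, |(y i : ℝ) - a i| ≤ δ →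
      1 ≤ ∑ i, {z : Fin d → I | |(z i : ℝ) - a i| ≤ δ}.indicator (fun _ => (1 : ℝ)) y := by
    intro i hi
    refine le_trans ?_ (Finset.single_le_sum hnn (Finset.mem_univ i))
    rw [Set.indicator_of_mem (show y ∈ {z : Fin d → I | |(z i : ℝ) - a i| ≤ δ} from hi)]
  by_cases h1 : y' ∈ Set.Icc 0 a <;> by_cases h2 : y ∈ Set.Icc 0 a
  · simpa [h1, h2] using Finset.sum_nonneg hnn
  · rw [hmem] at h1
    have h3 := h2
    rw [hmem] at h3
    push Not at h3
    obtain ⟨i, hi⟩ := h3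
    have ha := abs_le.1 (hy i)
    have hb := h1 i
    simpa [(hmem y').2 h1, h2] using hslab i (abs_le.2 ⟨by linarith, by linarith⟩)
  · have h3 := h1
    rw [hmem] at h2 h3
    push Not at h3
    obtain ⟨i, hi⟩ := h3
    have ha := abs_le.1 (hy i)
    have hb := h2 i
    simpa [(hmem y).2 h2, h1] using hslab i (abs_le.2 ⟨by linarith, by linarith⟩)
  · simpa [h1, h2] using Finset.sum_nonneg hnn

/-! ### The inequality for absolutely continuous measures -/

theorem le_starDiscrepancy {d N : ℕ} (x : Fin N → Fin d → I) (μ : Measure (Fin d → I))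
    [IsProbabilityMeasure μ] (a : Fin d → I) :
    |(1 / (N : ℝ)) * ∑ n, (Set.Icc 0 a).indicator (fun _ => (1 : ℝ)) (x n)
      - μ.real (Set.Icc 0 a)| ≤ starDiscrepancy x μ := by
  refine le_ciSup (f := fun a => |(1 / (N : ℝ)) *
    ∑ n, (Set.Icc 0 a).indicator (fun _ => (1 : ℝ)) (x n) - μ.real (Set.Icc 0 a)|) ?_ a
  refine ⟨1, ?_⟩
  rintro _ ⟨b, rfl⟩
  have h0 : 0 ≤ ∑ n, (Set.Icc 0 b).indicator (fun _ => (1 : ℝ)) (x n) :=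
    Finset.sum_nonneg fun n _ => Set.indicator_nonneg (fun _ _ => zero_le_one) _
  have h1 : ∑ n, (Set.Icc 0 b).indicator (fun _ => (1 : ℝ)) (x n) ≤ N := by
    refine (Finset.sum_le_card_nsmul _ _ 1 fun n _ =>
      Set.indicator_le' (fun _ _ => le_rfl) (fun _ _ => zero_le_one) _).trans ?_
    simp
  have h2 : (1 / (N : ℝ)) * ∑ n, (Set.Icc 0 b).indicator (fun _ => (1 : ℝ)) (x n) ≤ 1 := by
    rw [one_div, ← div_eq_inv_mul]
    exact div_le_one_of_le₀ h1 (Nat.cast_nonneg N)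
  have h3 := measureReal_le_one (μ := μ) (s := Set.Icc 0 b)
  have h4 : 0 ≤ μ.real (Set.Icc 0 b) := measureReal_nonneg
  have h5 : 0 ≤ (1 / (N : ℝ)) * ∑ n, (Set.Icc 0 b).indicator (fun _ => (1 : ℝ)) (x n) := by
    positivity
  exact abs_le.2 ⟨by linarith, by linarith⟩

theorem integrable_of_hkVariation_ne_top {d : ℕ} {h : (Fin d → I) → ℝ} (hm : Measurable h)
    (hV : hkVariation h ≠ ⊤) (μ : Measure (Fin d → I)) [IsFiniteMeasure μ] : Integrable h μ := by
  refine Integrable.of_bound hm.aestronglyMeasurable (|h 1| + (hkVariation h).toReal)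
    (Filter.Eventually.of_forall fun x => ?_)
  have := abs_add_le (h x - h 1) (h 1)
  rw [sub_add_cancel] at this
  have := abs_sub_apply_one_le hV x
  rw [Real.norm_eq_abs]
  linarith

/-- The inequality for the pushforward of `μ` to finitely many points, compared with equally
weighted points. -/
theorem abs_mean_sub_integral_comp_le {d N : ℕ} (hN : 1 ≤ N) {h : (Fin d → I) → ℝ}
    (hV : hkVariation h ≠ ⊤) (μ : Measure (Fin d → I)) [IsProbabilityMeasure μ]
    (x : Fin N → Fin d → I) {κ : Type*} [Fintype κ] [MeasurableSpace κ]
    [MeasurableSingletonClass κ] {q : (Fin d → I) → κ} (hq : Measurable q) (p : κ → Fin d → I)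
    {D : ℝ} (hD : ∀ a, |(1 / (N : ℝ)) * ∑ n, (Set.Icc 0 a).indicator (fun _ => (1 : ℝ)) (x n)
      - ∫ y, (Set.Icc 0 a).indicator (fun _ => (1 : ℝ)) (p (q y)) ∂μ| ≤ D) :
    |(1 / (N : ℝ)) * ∑ n, h (x n) - ∫ y, h (p (q y)) ∂μ| ≤ (hkVariation h).toReal * D := by
  have hN0 : (N : ℝ) ≠ 0 := by positivity
  have : IsProbabilityMeasure (μ.map q) := Measure.isProbabilityMeasure_map hq.aemeasurable
  let w : Fin N ⊕ κ → ℝ := Sum.elim (fun _ => 1 / (N : ℝ)) (fun c => -(μ.map q).real {c})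
  let z : Fin N ⊕ κ → Fin d → I := Sum.elim x p
  have hsum : ∀ φ : (Fin d → I) → ℝ, ∑ k, w k * φ (z k) =
      (1 / (N : ℝ)) * ∑ n, φ (x n) - ∫ y, φ (p (q y)) ∂μ := by
    intro φ
    have hi : Integrable (fun c => φ (p c)) (μ.map q) := Integrable.of_finite
    rw [← integral_map (f := fun c => φ (p c)) hq.aemeasurable hi.aestronglyMeasurable,
      integral_fintype hi]
    simp [w, z, Finset.mul_sum, sub_eq_add_neg]
  have hw : ∑ k, w k = 0 := by
    have := hsum fun _ => 1
    simpa [hN0] using this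
  rw [← hsum]
  exact abs_sum_mul_le hV w z hw fun a => by rw [hsum]; exact hD a

/-- The Koksma–Hlawka inequality for an absolutely continuous probability measure. -/
theorem koksma_hlawka_withDensity {d N : ℕ} (hN : 1 ≤ N) {h : (Fin d → I) → ℝ}
    (hm : Measurable h) (hV : hkVariation h ≠ ⊤) (G : (Fin d → I) → ENNReal)
    [IsProbabilityMeasure (volume.withDensity G)] (x : Fin N → Fin d → I) :
    |(1 / (N : ℝ)) * ∑ n, h (x n) - ∫ y, h y ∂(volume.withDensity G)| ≤
      (hkVariation h).toReal * starDiscrepancy x (volume.withDensity G) := by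
  set μ := volume.withDensity G with hμ
  have hG : ∫⁻ y, G y ≠ ⊤ := by
    rw [← setLIntegral_univ, ← withDensity_apply _ MeasurableSet.univ]
    exact measure_ne_top μ _
  set V := (hkVariation h).toReal with hVdef
  have hV0 : 0 ≤ V := ENNReal.toReal_nonneg
  have main : ∀ ε > 0, |(1 / (N : ℝ)) * ∑ n, h (x n) - ∫ y, h y ∂μ| ≤
      V * (starDiscrepancy x μ + d * ε) + ε := by
    intro ε hε
    obtain ⟨δ, hδ, hslab⟩ := exists_slab_measure_le hG hε
    let ψ : Option (Fin d) → (Fin d → I) → ℝ := fun o y => o.elim (h y) fun i => (y i : ℝ)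
    have hψ : ∀ o, Measurable (ψ o) := by
      rintro (_ | i)
      · exact hm
      · exact measurable_subtype_coe.comp (measurable_pi_apply i)
    have hψB : ∀ o y, |ψ o y| ≤ |h 1| + V + 1 := by
      rintro (_ | i) y
      · have h1 := abs_add_le (h y - h 1) (h 1)
        rw [sub_add_cancel] at h1
        have h2 := abs_sub_apply_one_le hV y
        change |h y| ≤ _
        linarith
      · have h1 := (y i).2
        change |(y i : ℝ)| ≤ _
        rw [abs_of_nonneg h1.1]
        linarith [h1.2, abs_nonneg (h 1)]
    obtain ⟨κ, _, _, _, q, p, hq, hqp⟩ :=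
      exists_finite_discretization ψ hψ hψB (lt_min hδ hε)
    have hfin : ∀ φ : (Fin d → I) → ℝ, Integrable (fun y => φ (p (q y))) μ := fun φ => by
      have : IsFiniteMeasure (μ.map q) := Measure.isFiniteMeasure_map μ q
      exact (Integrable.of_finite (μ := μ.map q) (f := fun c => φ (p c))).comp_measurable hq
    have hbox : ∀ a, |(1 / (N : ℝ)) * ∑ n, (Set.Icc 0 a).indicator (fun _ => (1 : ℝ)) (x n)
        - ∫ y, (Set.Icc 0 a).indicator (fun _ => (1 : ℝ)) (p (q y)) ∂μ| ≤
        starDiscrepancy x μ + d * ε := by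
      intro a
      have hT : ∀ i, MeasurableSet {y : Fin d → I | |(y i : ℝ) - a i| ≤ δ} := fun i =>
        measurableSet_le (by fun_prop) measurable_const
      have hint : Integrable ((Set.Icc 0 a).indicator fun _ => (1 : ℝ)) μ :=
        (integrable_const 1).indicator measurableSet_Icc
      have hsl : ∀ i ∈ Finset.univ, Integrable
          ({z : Fin d → I | |(z i : ℝ) - a i| ≤ δ}.indicator fun _ => (1 : ℝ)) μ :=
        fun i _ => (integrable_const 1).indicator (hT i)
      have hdiff : |∫ y, (Set.Icc 0 a).indicator (fun _ => (1 : ℝ)) (p (q y)) ∂μ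
          - μ.real (Set.Icc 0 a)| ≤ d * ε := by
        rw [← integral_indicator_one measurableSet_Icc]
        change |_ - ∫ y, (Set.Icc 0 a).indicator (fun _ => (1 : ℝ)) y ∂μ| ≤ _
        rw [← integral_sub (hfin _) hint]
        refine abs_integral_le_integral_abs.trans ?_
        refine (integral_mono ((hfin _).sub hint).abs (integrable_finsetSum _ hsl)
          fun y => ?_).trans ?_
        · exact abs_indicator_sub_le a y (p (q y)) fun i =>
            (hqp (some i) y).trans (min_le_left _ _)
        · rw [integral_finsetSum _ hsl]
          refine (Finset.sum_le_card_nsmul _ _ ε fun i _ => ?_).trans (by simp)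
          exact (integral_indicator_one (hT i)).le.trans (hslab i (a i))
      have h1 := le_starDiscrepancy x μ a
      rw [abs_le] at *
      constructor <;> linarith [h1.1, h1.2, hdiff.1, hdiff.2]
    have h1 := abs_mean_sub_integral_comp_le hN hV μ x hq p hbox
    have h2 : |∫ y, h (p (q y)) ∂μ - ∫ y, h y ∂μ| ≤ ε := by
      have hint := integrable_of_hkVariation_ne_top hm hV μ
      rw [← integral_sub (hfin _) hint]
      refine abs_integral_le_integral_abs.trans ?_
      refine (integral_mono ((hfin _).sub hint).abs (integrable_const ε) fun y =>
        (hqp none y).trans (min_le_right _ _)).trans ?_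
      simp
    rw [abs_le] at *
    constructor <;> linarith [h1.1, h1.2, h2.1, h2.2]
  refine le_of_forall_pos_le_add fun η hη => ?_
  have hc : 0 < V * d + 1 := by positivity
  refine (main (η / (V * d + 1)) (by positivity)).trans (le_of_eq ?_)
  field_simp
  ring

end QMC

theorem corollary2 (d N : ℕ) (hN : 1 ≤ N) (f g : (Fin d → I) → ℝ)
    (hf : Measurable f) (hg : Measurable g) (hgpos : ∀ x, 0 < g x)
    (μg : Measure (Fin d → I)) [IsProbabilityMeasure μg]
    (hμg : μg = volume.withDensity (fun x => ENNReal.ofReal (g x)))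
    (hfg : QMC.hkVariation (fun x => f x / g x) < ⊤)
    (x : Fin N → Fin d → I) :
    Integrable f volume ∧
      |(1 / (N : ℝ)) * ∑ n, f (x n) / g (x n) - ∫ y, f y| ≤
        (QMC.hkVariation (fun y => f y / g y)).toReal * QMC.starDiscrepancy x μg := by
  subst hμg
  have hm : Measurable fun x => f x / g x := hf.div hg
  have hG : Measurable fun x => ENNReal.ofReal (g x) := hg.ennreal_ofReal
  have hfin : ∀ᵐ x : Fin d → I, ENNReal.ofReal (g x) < ⊤ :=
    Filter.Eventually.of_forall fun _ => ENNReal.ofReal_lt_top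
  have hcancel : (fun x => (ENNReal.ofReal (g x)).toReal • (f x / g x)) = f := by
    funext x
    rw [ENNReal.toReal_ofReal (hgpos x).le, smul_eq_mul, mul_div_cancel₀ _ (hgpos x).ne']
  constructor
  · have := (integrable_withDensity_iff_integrable_smul' hG hfin).1
      (QMC.integrable_of_hkVariation_ne_top hm hfg.ne _)
    rwa [hcancel] at this
  · have := QMC.koksma_hlawka_withDensity hN hm hfg.ne (fun x => ENNReal.ofReal (g x)) x
    rwa [integral_withDensity_eq_integral_toReal_smul hG hfin, hcancel] at this
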